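/- Let $k$ be an algebraically closed field and let $n\ge 3$. Matrices $A,B\in\mathrm{Mat}_{n\times n}(k)$ are said to polynomially commute if there exist polynomials $p,q\in k[x]$ with $1\le\deg p\le n-1$ and $1\le\deg q\le n-1$ such that $p(A)q(B)=q(B)p(A)$. Let $\mathcal{PC}_n\subseteq \mathrm{Mat}_{n\times n}(k)^2$ be the set of all pairs $(A,B)$ of polynomially commuting matrices. Then $\mathcal{PC}_n$ is an affine variety in the $2n^2$-dimensional affine space $\mathrm{Mat}_{n\times n}(k)^2$, i.e. the common vanishing locus of finitely many polynomials in the entries of $A$ and $B$ (irreducibility is not part of the definition). Moreover, let $V=\{c_1x+\dots+c_{n-1}x^{n-1} : c_i\in k\}$ be the vector space of polynomials of degree at most $n-1$ without constant term, let $\mathbb P(V)$ be its projectivization, and write $\langle p\rangle\in\mathbb P(V)$ for the class of $p\in V\setminus\{0\}$. Then the incidence set $$\Phi=\{(A,B,\langle p\rangle,\langle q\rangle) : p(A)q(B)=q(B)p(A)\}\subseteq \mathrm{Mat}_{n\times n}(k)^2\times\mathbb P(V)\times\mathbb P(V)$$ is Zariski closed, i.e. it is the vanishing locus of a collection of polynomials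 in the coordinates of $(A,B)$, $p$ and $q$, each homogeneous in the coefficients of $p$ and homogeneous in the coefficients of $q$; and the image of $\Phi$ under the projection $\mathrm{Mat}_{n\times n}(k)^2\times\mathbb P(V)\times\mathbb P(V)\to \mathrm{Mat}_{n\times n}(k)^2$ equals $\mathcal{PC}_n$. -/

import Mathlib

open scoped LinearAlgebra.Projectivization

namespace PolyCommuting

/-- The set of pairs `(A, B)` of `n × n` matrices over `k`, i.e. `Mat²`. -/
abbrev MatPair (k : Type*) (n : ℕ) : Type _ :=
  Matrix (Fin n) (Fin n) k × Matrix (Fin n) (Fin n) k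

/-- Index set of the `2n²` affine coordinates on `Mat²`: `inl (i, j)` stands for the `(i, j)` entry
of the first matrix, `inr (i, j)` for the `(i, j)` entry of the second one. -/
abbrev PairIdx (n : ℕ) : Type := (Fin n × Fin n) ⊕ (Fin n × Fin n)

/-- The point of `2n²`-dimensional affine space given by the entries of a pair of matrices. -/
def pairCoords {k : Type*} {n : ℕ} (M : MatPair k n) : PairIdx n → k :=
  Sum.elim (fun ij => M.1 ij.1 ij.2) (fun ij => M.2 ij.1 ij.2)

/-- `S ⊆ k^σ` is an affine variety: the common vanishing locus of finitely many polynomials. -/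
def IsAffineVariety {k σ : Type*} [Field k] (S : Set (σ → k)) : Prop :=
  ∃ F : Finset (MvPolynomial σ k), S = {a | ∀ f ∈ F, MvPolynomial.eval a f = 0}

/-- Two matrices polynomially commute: `p(A)` commutes with `q(B)` for some polynomials `p`, `q`
of degrees between `1` and `n - 1`. -/
def PolynomiallyCommute {k : Type*} [Field k] {n : ℕ} (A B : Matrix (Fin n) (Fin n) k) : Prop :=
  ∃ p q : Polynomial k,
    (1 ≤ p.natDegree ∧ p.natDegree ≤ n - 1) ∧ (1 ≤ q.natDegree ∧ q.natDegree ≤ n - 1) ∧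
      Commute (Polynomial.aeval A p) (Polynomial.aeval B q)

/-- The set `PC_n` of all pairs of polynomially commuting matrices. -/
def PC (k : Type*) [Field k] (n : ℕ) : Set (MatPair k n) :=
  {M | PolynomiallyCommute M.1 M.2}

/-- The vector space `V` of polynomials of degree less than `n` without constant term. -/
noncomputable def polySpace (k : Type*) [Field k] (n : ℕ) : Submodule k (Polynomial k) :=
  Polynomial.degreeLT k n ⊓ LinearMap.ker (Polynomial.lcoeff k 0)

/-- The coordinates `(c₁, …, c_{n-1})` of `c₁ x + ⋯ + c_{n-1} x^{n-1} ∈ V`. -/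
noncomputable def polyCoords {k : Type*} [Field k] {n : ℕ} (p : polySpace k n) : Fin (n - 1) → k :=
  fun i => (p : Polynomial k).coeff (i + 1)

/-- Index set for the variables of `k[Mat² × V × V]`. -/
abbrev MixedIdx (n : ℕ) : Type := PairIdx n ⊕ (Fin (n - 1) ⊕ Fin (n - 1))

/-- The coordinates of a point `(A, B, p, q)` of `Mat² × V × V`. -/
noncomputable def mixedCoords {k : Type*} [Field k] {n : ℕ} (M : MatPair k n) (p q : polySpace k n) :
    MixedIdx n → k :=
  Sum.elim (pairCoords M) (Sum.elim (polyCoords p) (polyCoords q))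

/-- `f` is homogeneous in the variables of the first copy of `V`, and also homogeneous
in the variables of the second copy of `V`. -/
def IsBihomogeneous {k : Type*} [Field k] {n : ℕ} (f : MvPolynomial (MixedIdx n) k) : Prop :=
  (∃ d : ℕ, f.IsWeightedHomogeneous
      (Sum.elim (fun _ => 0) (Sum.elim (fun _ => 1) (fun _ => 0)) : MixedIdx n → ℕ) d) ∧
    (∃ e : ℕ, f.IsWeightedHomogeneous
      (Sum.elim (fun _ => 0) (Sum.elim (fun _ => 0) (fun _ => 1)) : MixedIdx n → ℕ) e)

/-- A subset of `Mat² × ℙ(V) × ℙ(V)` is Zariski closed: it is the vanishing locus of a collection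
of polynomials that are homogeneous in the coordinates of each projective factor. The choice of
representatives does not matter, see `IsBihomogeneous.eval_rep_eq_zero_iff`. -/
def IsZariskiClosedMixed {k : Type*} [Field k] {n : ℕ}
    (Z : Set (MatPair k n × ℙ k (polySpace k n) × ℙ k (polySpace k n))) : Prop :=
  ∃ F : Set (MvPolynomial (MixedIdx n) k), (∀ f ∈ F, IsBihomogeneous f) ∧
    Z = {z | ∀ f ∈ F, MvPolynomial.eval (mixedCoords z.1 z.2.1.rep z.2.2.rep) f = 0}

/-- The incidence correspondence
`Φ = {(A, B, ⟨p⟩, ⟨q⟩) | p(A) q(B) = q(B) p(A)} ⊆ Mat² × ℙ(V) × ℙ(V)`. The choice of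
representatives does not matter, see `mk_mem_incidence_iff`. -/
def incidence (k : Type*) [Field k] (n : ℕ) :
    Set (MatPair k n × ℙ k (polySpace k n) × ℙ k (polySpace k n)) :=
  {z | Commute (Polynomial.aeval z.1.1 (z.2.1.rep : Polynomial k))
        (Polynomial.aeval z.1.2 (z.2.2.rep : Polynomial k))}

theorem pairCoords_bijective {k : Type*} {n : ℕ} :
    Function.Bijective (pairCoords : MatPair k n → PairIdx n → k) := by
  refine ⟨fun M N h => ?_, fun a => ⟨(fun i j => a (Sum.inl (i, j)), fun i j => a (Sum.inr (i, j))),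
    ?_⟩⟩
  · refine Prod.ext ?_ ?_ <;> ext i j
    · exact congrFun h (Sum.inl (i, j))
    · exact congrFun h (Sum.inr (i, j))
  · funext x
    rcases x with x | x <;> rfl

theorem mem_polySpace {k : Type*} [Field k] {n : ℕ} {p : Polynomial k} :
    p ∈ polySpace k n ↔ p.degree < n ∧ p.coeff 0 = 0 := by
  simp [polySpace, Polynomial.mem_degreeLT]

/-- Membership in the incidence correspondence may be tested on any representatives. -/
theorem mk_mem_incidence_iff {k : Type*} [Field k] {n : ℕ} (M : MatPair k n)
    (p q : polySpace k n) (hp : p ≠ 0) (hq : q ≠ 0) :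
    (M, Projectivization.mk k p hp, Projectivization.mk k q hq) ∈ incidence k n ↔
      Commute (Polynomial.aeval M.1 (p : Polynomial k))
        (Polynomial.aeval M.2 (q : Polynomial k)) := by
  obtain ⟨a, ha⟩ := Projectivization.exists_smul_eq_mk_rep k p hp
  obtain ⟨b, hb⟩ := Projectivization.exists_smul_eq_mk_rep k q hq
  simp only [incidence, Set.mem_ofPred_eq, ← ha, ← hb, Units.smul_def, Submodule.coe_smul, map_smul]
  rw [← Units.smul_def, ← Units.smul_def, Commute.smul_left_iff, Commute.smul_right_iff]

/-- Rescaling the variables with weight one rescales a weighted homogeneous polynomial. -/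
theorem eval_scale {k σ : Type*} [Field k] (w : σ → ℕ) (d : ℕ) (f : MvPolynomial σ k)
    (hf : f.IsWeightedHomogeneous w d) (c : k) (x : σ → k) :
    MvPolynomial.eval (fun i => c ^ w i * x i) f = c ^ d * MvPolynomial.eval x f := by
  rw [MvPolynomial.eval_eq, MvPolynomial.eval_eq, Finset.mul_sum]
  refine Finset.sum_congr rfl fun m hm => ?_
  have h := hf (MvPolynomial.mem_support_iff.mp hm)
  rw [← h, Finsupp.weight_apply, Finsupp.sum, ← Finset.prod_pow_eq_pow_sum]
  simp only [mul_pow, Finset.prod_mul_distrib, ← pow_mul, smul_eq_mul, mul_comm (w _)]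
  ring

/-- The vanishing of a bihomogeneous polynomial may be tested on any representatives. -/
theorem IsBihomogeneous.eval_rep_eq_zero_iff {k : Type*} [Field k] {n : ℕ}
    {f : MvPolynomial (MixedIdx n) k} (hf : IsBihomogeneous f) (M : MatPair k n)
    (p q : polySpace k n) (hp : p ≠ 0) (hq : q ≠ 0) :
    MvPolynomial.eval (mixedCoords M (Projectivization.mk k p hp).rep
        (Projectivization.mk k q hq).rep) f = 0 ↔
      MvPolynomial.eval (mixedCoords M p q) f = 0 := by
  obtain ⟨⟨d, hd⟩, e, he⟩ := hf
  obtain ⟨a, ha⟩ := Projectivization.exists_smul_eq_mk_rep k p hp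
  obtain ⟨b, hb⟩ := Projectivization.exists_smul_eq_mk_rep k q hq
  have h1 := eval_scale _ d f hd (a : k) (mixedCoords M p (b • q))
  have h2 := eval_scale _ e f he (b : k) (mixedCoords M p q)
  rw [← ha, ← hb]
  have e1 : mixedCoords M (a • p) (b • q) = fun i =>
      (a : k) ^ ((Sum.elim (fun _ => 0) (Sum.elim (fun _ => 1) (fun _ => 0)) : MixedIdx n → ℕ) i) *
        mixedCoords M p (b • q) i := by
    funext i
    rcases i with i | i | i <;> simp [mixedCoords, polyCoords, Units.smul_def]
  have e2 : mixedCoords M p (b • q) = fun i =>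
      (b : k) ^ ((Sum.elim (fun _ => 0) (Sum.elim (fun _ => 0) (fun _ => 1)) : MixedIdx n → ℕ) i) *
        mixedCoords M p q i := by
    funext i
    rcases i with i | i | i <;> simp [mixedCoords, polyCoords, Units.smul_def]
  rw [e1, h1, e2, h2]
  simp

end PolyCommuting

/-!
The entries of `[p(A), q(B)]` are bilinear in the coefficient vectors of `p` and `q`, with
coefficients that are polynomials in the entries of `A` and `B` (`commute_aeval_iff`). This presents
the incidence set as the vanishing locus of bihomogeneous polynomials. Subtracting constant terms
from `p` and `q` does not change whether `p(A)` and `q(B)` commute, so `PC` is the projection of the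
incidence set (`mem_PC_iff_exists_polySpace`).

It remains to eliminate the two projective factors (`isAffineVariety_exists_bilinear_zero`). For
given `A`, `B` and `q`, a nonzero `p` exists if and only if a linear system is rank deficient, i.e.
all its maximal minors vanish; these minors are homogeneous in the coefficients of `q`. Eliminating
`q` is the main theorem of elimination theory for a single projective space
(`isAffineVariety_exists_common_zero`). By the Nullstellensatz, homogeneous polynomials have no
common zero except the origin if and only if their multiples exhaust all forms of some degree `e`
(`exists_ne_zero_forall_eval_eq_zero_iff`). For each `e` the failure of this is again a rank
deficiency, hence expressed by the vanishing of minors, which are polynomials in the entries of `A`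
and `B`. By Hilbert's basis theorem, finitely many of the resulting equations, over all `e`, suffice.
-/

namespace PolyCommuting
open MvPolynomial

/-! ### Families of vectors that do not span -/

/-- Vectors fail to span `k^ι` exactly when all their maximal minors vanish. -/
theorem span_range_eq_top_iff_exists_det_ne_zero {k ι S : Type*} [Field k] [Fintype ι]
    [DecidableEq ι] (v : S → ι → k) :
    Submodule.span k (Set.range v) = ⊤ ↔ ∃ g : ι → S, (Matrix.of fun i => v (g i)).det ≠ 0 := by
  constructor
  · intro h
    obtain ⟨κ, a, -, ha, hli⟩ := exists_linearIndependent' k v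
    let b : Module.Basis κ k (ι → k) := Module.Basis.mk hli (by rw [ha, h])
    let e : ι ≃ κ := (Pi.basisFun k ι).indexEquiv b
    refine ⟨a ∘ e, ?_⟩
    have hli' : LinearIndependent k (Matrix.of fun i => v ((a ∘ e) i)).row :=
      hli.comp e e.injective
    rw [Matrix.linearIndependent_rows_iff_isUnit, Matrix.isUnit_iff_isUnit_det] at hli'
    exact hli'.ne_zero
  · rintro ⟨g, hg⟩
    have hli : LinearIndependent k (Matrix.of fun i => v (g i)).row := by
      rw [Matrix.linearIndependent_rows_iff_isUnit, Matrix.isUnit_iff_isUnit_det]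
      exact hg.isUnit
    have htop := hli.span_eq_top_of_card_eq_finrank' (by simp)
    rw [eq_top_iff, ← htop]
    refine Submodule.span_mono ?_
    rintro _ ⟨i, rfl⟩
    exact ⟨g i, rfl⟩

theorem span_range_ne_top_iff_exists_dotProduct_eq_zero {k ι S : Type*} [Field k] [Fintype ι]
    (v : S → ι → k) :
    Submodule.span k (Set.range v) ≠ ⊤ ↔ ∃ a : ι → k, a ≠ 0 ∧ ∀ s, a ⬝ᵥ v s = 0 := by
  classical
  constructor
  · intro h
    obtain ⟨φ, hφ, hle⟩ := Submodule.exists_le_ker_of_lt_top _ (lt_top_iff_ne_top.mpr h)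
    obtain ⟨a, rfl⟩ := (dotProductEquiv k ι).surjective φ
    refine ⟨a, fun h0 => hφ (by rw [h0, map_zero]), fun s => ?_⟩
    simpa using hle (Submodule.subset_span ⟨s, rfl⟩)
  · rintro ⟨a, ha, h⟩ htop
    refine ha (funext fun i => ?_)
    have hle : Submodule.span k (Set.range v) ≤ LinearMap.ker (dotProductEquiv k ι a) := by
      rw [Submodule.span_le]
      rintro _ ⟨s, rfl⟩
      simpa using h s
    have : Pi.single i (1 : k) ∈ LinearMap.ker (dotProductEquiv k ι a) :=
      hle (htop ▸ Submodule.mem_top)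
    simpa using this

/-! ### Common zeros of homogeneous polynomials -/

/-- The vector of degree `e` coefficients of a polynomial. -/
noncomputable def degreeCoeffs (k τ : Type*) [Field k] (e : ℕ) :
    MvPolynomial τ k →ₗ[k] ({m : τ →₀ ℕ // m.degree = e} → k) :=
  LinearMap.pi fun m => lcoeff k m.1

theorem degreeCoeffs_apply {k τ : Type*} [Field k] (e : ℕ) (p : MvPolynomial τ k)
    (m : {m : τ →₀ ℕ // m.degree = e}) : degreeCoeffs k τ e p m = coeff m.1 p := rfl

instance finite_finsupp_degree_eq {τ : Type*} [Finite τ] (e : ℕ) :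
    Finite {m : τ →₀ ℕ // m.degree = e} :=
  Finsupp.finite_of_degree_eq e

/-- As a vector space, an ideal is spanned by the products of its generators with monomials, so its
degree `e` coefficient vectors are spanned by those of these products. -/
theorem degreeCoeffs_mem_span {k τ S : Type*} [Field k] (f : S → MvPolynomial τ k) (e : ℕ)
    {p : MvPolynomial τ k} (hp : p ∈ Ideal.span (Set.range f)) :
    degreeCoeffs k τ e p ∈ Submodule.span k (Set.range fun as : (τ →₀ ℕ) × S =>
      degreeCoeffs k τ e (monomial as.1 1 * f as.2)) := by
  obtain ⟨c, rfl⟩ := Finsupp.mem_ideal_span_range_iff_exists_finsupp.mp hp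
  rw [Finsupp.sum, map_sum]
  refine Submodule.sum_mem _ fun s _ => ?_
  rw [(c s).as_sum, Finset.sum_mul, map_sum]
  refine Submodule.sum_mem _ fun a _ => ?_
  rw [← mul_one (coeff a (c s)), ← smul_eq_mul (coeff a (c s)), ← smul_monomial, smul_mul_assoc,
    map_smul]
  exact Submodule.smul_mem _ _ (Submodule.subset_span ⟨(a, s), rfl⟩)

/-- Projective Nullstellensatz: homogeneous polynomials `f s` have a common zero other than the
origin if and only if in no degree `e` do their multiples exhaust all forms of degree `e`. All
monomial multiples are admitted on the right; as each is homogeneous, those of a degree other than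
`e` contribute the zero vector. -/
theorem exists_ne_zero_forall_eval_eq_zero_iff {k τ S : Type*} [Field k] [IsAlgClosed k]
    [Finite τ] (f : S → MvPolynomial τ k) (d : S → ℕ) (hf : ∀ s, (f s).IsHomogeneous (d s)) :
    (∃ b : τ → k, b ≠ 0 ∧ ∀ s, eval b (f s) = 0) ↔
      ∀ e, Submodule.span k (Set.range fun as : (τ →₀ ℕ) × S =>
        degreeCoeffs k τ e (monomial as.1 1 * f as.2)) ≠ ⊤ := by
  classical
  constructor
  · rintro ⟨b, hb, hfb⟩ e
    have := Fintype.ofFinite {m : τ →₀ ℕ // m.degree = e}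
    rw [span_range_ne_top_iff_exists_dotProduct_eq_zero]
    -- Evaluation at `b` is a nonzero functional on forms of degree `e` that kills the multiples.
    refine ⟨fun m => eval b (monomial m.1 1), fun h => hb (funext fun j => ?_), ?_⟩
    · have := congrFun h ⟨Finsupp.single j e, by simp⟩
      simp only [eval_monomial, Pi.zero_apply, one_mul] at this
      rw [Finsupp.prod_single_index (by simp)] at this
      exact eq_zero_of_pow_eq_zero this
    · rintro ⟨a, s⟩
      have hh : (monomial a 1 * f s).IsHomogeneous (a.degree + d s) :=
        (isHomogeneous_monomial 1 rfl).mul (hf s)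
      have h0 : eval b (monomial a 1 * f s) = 0 := by rw [map_mul, hfb, mul_zero]
      generalize monomial a 1 * f s = p at hh h0
      simp only [dotProduct, degreeCoeffs_apply]
      by_cases he : a.degree + d s = e
      · rw [p.as_sum, map_sum] at h0
        rw [← h0]
        symm
        refine Finset.sum_bij_ne_zero (fun m hm _ => ⟨m, ?_⟩) ?_ ?_ ?_ ?_
        · rw [← he]
          by_contra hne
          exact (mem_support_iff.mp hm) (hh.coeff_eq_zero hne)
        · simp
        · intro m _ _ m' _ _ h
          simpa using h
        · intro m _ hm
          have : coeff m.1 p ≠ 0 := right_ne_zero_of_mul hm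
          refine ⟨m.1, mem_support_iff.mpr this, ?_, rfl⟩
          simpa [eval_monomial, mul_comm] using hm
        · intro m _ _
          simp [eval_monomial, mul_comm]
      · refine Finset.sum_eq_zero fun m _ => ?_
        rw [hh.coeff_eq_zero (by rw [m.2]; exact Ne.symm he), mul_zero]
  · intro h
    by_contra! hno
    set I := Ideal.span (Set.range f)
    have hle : idealOfVars τ k ≤ I.radical := by
      rw [← vanishingIdeal_zeroLocus_eq_radical (K := k), idealOfVars, Ideal.span_le]
      rintro _ ⟨j, rfl⟩ b hb
      have hb0 : b = 0 := by
        by_contra hb0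
        obtain ⟨s, hs⟩ := hno b hb0
        exact hs (by simpa [aeval_eq_eval] using hb (f s) (Ideal.subset_span ⟨s, rfl⟩))
      simp [hb0]
    -- By the Nullstellensatz all monomials of some degree `N` lie in the ideal of the `f s`.
    obtain ⟨N, hN⟩ := Ideal.exists_pow_le_of_le_radical_of_fg hle (IsNoetherian.noetherian _)
    have := Fintype.ofFinite {m : τ →₀ ℕ // m.degree = N}
    refine h N (eq_top_iff.mpr ?_)
    rw [← (Pi.basisFun k {m : τ →₀ ℕ // m.degree = N}).span_eq, Submodule.span_le]
    rintro _ ⟨m, rfl⟩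
    have hm : monomial m.1 (1 : k) ∈ I := hN (by
      rw [monomial_mem_pow_idealOfVars_iff _ _ one_ne_zero]
      exact m.2.ge)
    convert! degreeCoeffs_mem_span f N hm using 1
    ext m'
    simp [degreeCoeffs_apply, coeff_monomial, Pi.single_apply, Subtype.ext_iff, eq_comm]

/-! ### Elimination of projective variables -/

/-- By Hilbert's basis theorem, finitely many equations suffice. -/
theorem isAffineVariety_of_eq_zeros {k σ : Type*} [Field k] [Finite σ] {Z : Set (σ → k)}
    (F : Set (MvPolynomial σ k)) (hZ : ∀ x, x ∈ Z ↔ ∀ f ∈ F, eval x f = 0) :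
    IsAffineVariety Z := by
  obtain ⟨G, hG⟩ := (IsNoetherian.noetherian (Ideal.span F) : (Ideal.span F).FG)
  refine ⟨G, Set.ext fun x => ?_⟩
  have key (H : Set (MvPolynomial σ k)) :
      (∀ f ∈ H, eval x f = 0) ↔ Ideal.span H ≤ RingHom.ker (eval x) := by
    rw [Ideal.span_le]; rfl
  rw [hZ, key, ← hG, ← Ideal.span, ← key]
  rfl

/-- Main theorem of elimination theory: the image in `k^σ` of a closed subset of `k^σ × ℙ(k^τ)`,
given by polynomials `f s` homogeneous in the variables `τ`, is closed. Its equations are the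
maximal minors, for every `e`, of the matrix of degree `e` coefficients of the monomial multiples
of the `f s`. -/
theorem isAffineVariety_exists_common_zero {k σ τ S : Type*} [Field k] [IsAlgClosed k] [Finite σ]
    [Finite τ] (f : S → MvPolynomial τ (MvPolynomial σ k)) (d : S → ℕ)
    (hf : ∀ s, (f s).IsHomogeneous (d s)) :
    IsAffineVariety {x : σ → k | ∃ b : τ → k, b ≠ 0 ∧ ∀ s, eval b (map (eval x) (f s)) = 0} := by
  classical
  have (e : ℕ) := Fintype.ofFinite {m : τ →₀ ℕ // m.degree = e}
  refine isAffineVariety_of_eq_zeros {p | ∃ e, ∃ g : {m : τ →₀ ℕ // m.degree = e} → (τ →₀ ℕ) × S,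
    p = (Matrix.of fun i j : {m : τ →₀ ℕ // m.degree = e} =>
      coeff j.1 (monomial (g i).1 1 * f (g i).2)).det} fun x => ?_
  rw [Set.mem_ofPred_eq, exists_ne_zero_forall_eval_eq_zero_iff _ d fun s => (hf s).map _]
  have hdet (e : ℕ) (g : {m : τ →₀ ℕ // m.degree = e} → (τ →₀ ℕ) × S) :
      eval x (Matrix.of fun i j : {m : τ →₀ ℕ // m.degree = e} =>
        coeff j.1 (monomial (g i).1 1 * f (g i).2)).det =
      (Matrix.of fun i => degreeCoeffs k τ e
        (monomial (g i).1 1 * map (eval x) (f (g i).2))).det := by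
    rw [RingHom.map_det]
    congr 1
    ext i j
    simp [degreeCoeffs_apply, ← coeff_map]
  simp only [ne_eq, span_range_eq_top_iff_exists_det_ne_zero, not_exists, not_not,
    Set.mem_ofPred_eq, forall_exists_index]
  constructor
  · rintro h _ e g rfl
    rw [hdet, h]
  · intro h e g
    rw [← hdet, h _ e g rfl]

theorem isHomogeneous_det {R κ ι : Type*} [CommRing R] [Fintype ι] [DecidableEq ι]
    (M : Matrix ι ι (MvPolynomial κ R)) (hM : ∀ i j, (M i j).IsHomogeneous 1) :
    M.det.IsHomogeneous (Fintype.card ι) := by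
  rw [Matrix.det_apply]
  refine IsHomogeneous.sum _ _ _ fun π _ => ?_
  rw [Units.smul_def, ← mem_homogeneousSubmodule]
  refine zsmul_mem ?_ _
  simpa using IsHomogeneous.prod Finset.univ (fun i => M (π i) i) (fun _ => 1) fun i _ => hM _ _

/-- The parameters for which a system of bilinear equations has a solution `(a, b)` with `a ≠ 0` and
`b ≠ 0` form a closed set. -/
theorem isAffineVariety_exists_bilinear_zero {k σ ι κ T : Type*} [Field k] [IsAlgClosed k]
    [Finite σ] [Fintype ι] [Fintype κ] (c : T → ι → κ → MvPolynomial σ k) :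
    IsAffineVariety {x : σ → k | ∃ a : ι → k, ∃ b : κ → k, a ≠ 0 ∧ b ≠ 0 ∧
      ∀ t, ∑ i, ∑ l, a i * b l * eval x (c t i l) = 0} := by
  classical
  -- For given `b`, the equations are linear in `a`, and `f g` is a maximal minor of this system.
  let f (g : ι → T) : MvPolynomial κ (MvPolynomial σ k) :=
    (Matrix.of fun i j => ∑ l, C (c (g i) j l) * X l).det
  have hf (g : ι → T) : (f g).IsHomogeneous (Fintype.card ι) :=
    isHomogeneous_det _ fun i j => IsHomogeneous.sum _ _ _ fun l _ => isHomogeneous_C_mul_X _ _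
  convert isAffineVariety_exists_common_zero f (fun _ => Fintype.card ι) hf using 1
  ext x
  simp only [Set.mem_ofPred_eq]
  rw [exists_comm]
  refine exists_congr fun b => ?_
  rw [show (∃ a : ι → k, a ≠ 0 ∧ b ≠ 0 ∧ ∀ t, ∑ i, ∑ l, a i * b l * eval x (c t i l) = 0) ↔
    b ≠ 0 ∧ ∃ a : ι → k, a ≠ 0 ∧ ∀ t, a ⬝ᵥ (fun i => ∑ l, eval x (c t i l) * b l) = 0 by
      simp only [dotProduct, Finset.mul_sum, mul_assoc, mul_comm (b _)]
      tauto]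
  rw [← span_range_ne_top_iff_exists_dotProduct_eq_zero, ne_eq (Submodule.span _ _),
    span_range_eq_top_iff_exists_det_ne_zero]
  simp only [not_exists, not_not]
  refine and_congr_right fun _ => forall_congr' fun g => ?_
  simp only [f, RingHom.map_det]
  refine Eq.congr (congrArg _ ?_) rfl
  ext i j
  simp

/-! ### Coordinates on polynomials without constant term -/

theorem aeval_eq_sum_polyCoords {k : Type*} [Field k] {n : ℕ} {R : Type*} [Ring R] [Algebra k R]
    (A : R) (p : polySpace k n) :
    Polynomial.aeval A (p : Polynomial k) = ∑ i, polyCoords p i • A ^ (i + 1 : ℕ) := by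
  obtain ⟨hdeg, h0⟩ := mem_polySpace.mp p.2
  rcases n with _ | n
  -- For `n = 0` the space is trivial, and `n - 1` does not fall short of `n` by one.
  · have : (p : Polynomial k) = 0 := by simpa using hdeg
    simp [this]
  have hnat : (p : Polynomial k).natDegree < n + 1 := by
    by_cases hp : (p : Polynomial k) = 0
    · simp [hp]
    · exact (Polynomial.natDegree_lt_iff_degree_lt hp).mpr hdeg
  rw [Polynomial.aeval_eq_sum_range' (n := n + 1) hnat,
    Finset.sum_range_succ', h0, zero_smul, add_zero, Finset.sum_range]
  rfl

theorem polyCoords_bijective {k : Type*} [Field k] {n : ℕ} :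
    Function.Bijective (polyCoords : polySpace k n → Fin (n - 1) → k) := by
  constructor
  · intro p q h
    have hp := aeval_eq_sum_polyCoords (Polynomial.X : Polynomial k) p
    have hq := aeval_eq_sum_polyCoords (Polynomial.X : Polynomial k) q
    rw [h, ← hq] at hp
    simpa using hp
  · intro c
    let p : Polynomial k := ∑ i : Fin (n - 1), Polynomial.monomial (i + 1 : ℕ) (c i)
    have hp : p ∈ polySpace k n := by
      refine Submodule.sum_mem _ fun i _ => mem_polySpace.mpr ⟨?_, ?_⟩
      · refine (Polynomial.degree_monomial_le _ _).trans_lt ?_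
        exact_mod_cast (by omega : (i : ℕ) + 1 < n)
      · simp [Polynomial.coeff_monomial]
    refine ⟨⟨p, hp⟩, funext fun i => ?_⟩
    simp [polyCoords, p, Polynomial.coeff_monomial, Fin.val_inj]

theorem polyCoords_eq_zero_iff {k : Type*} [Field k] {n : ℕ} {p : polySpace k n} :
    polyCoords p = 0 ↔ p = 0 := by
  have h0 : polyCoords (0 : polySpace k n) = 0 := by ext; simp [polyCoords]
  rw [← h0, polyCoords_bijective.injective.eq_iff]

/-! ### Polynomially commuting matrices -/

/-- The universal pair of `n × n` matrices, whose entries are the coordinates on `Mat²`. -/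
noncomputable def genericPair (k : Type*) [Field k] (n : ℕ) :
    MatPair (MvPolynomial (PairIdx n) k) n :=
  (Matrix.of fun i j => X (Sum.inl (i, j)), Matrix.of fun i j => X (Sum.inr (i, j)))

/-- The `rs` entry of `[A ^ (i + 1), B ^ (l + 1)]` as a polynomial in the entries of `A` and `B`.
It is the coefficient of `p i * q l` in the `rs` entry of `[p(A), q(B)]`, where `p i` stands for the
coefficient of `x ^ (i + 1)` in `p`, in agreement with the indexing of `polyCoords`. -/
noncomputable def commutatorCoeff (k : Type*) [Field k] (n : ℕ) (rs : Fin n × Fin n)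
    (i l : Fin (n - 1)) : MvPolynomial (PairIdx n) k :=
  ⁅(genericPair k n).1 ^ (i + 1 : ℕ), (genericPair k n).2 ^ (l + 1 : ℕ)⁆ rs.1 rs.2

theorem eval_commutatorCoeff {k : Type*} [Field k] {n : ℕ} (M : MatPair k n) (rs : Fin n × Fin n)
    (i l : Fin (n - 1)) :
    eval (pairCoords M) (commutatorCoeff k n rs i l) =
      ⁅M.1 ^ (i + 1 : ℕ), M.2 ^ (l + 1 : ℕ)⁆ rs.1 rs.2 := by
  have h1 : (eval (pairCoords M)).mapMatrix (genericPair k n).1 = M.1 := by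
    ext; simp [genericPair, pairCoords]
  have h2 : (eval (pairCoords M)).mapMatrix (genericPair k n).2 = M.2 := by
    ext; simp [genericPair, pairCoords]
  conv_rhs => rw [← h1, ← h2, Ring.lie_def, ← map_pow, ← map_pow, ← map_mul, ← map_mul, ← map_sub]
  simp [commutatorCoeff, Ring.lie_def]

/-- The condition `p(A) q(B) = q(B) p(A)` is bilinear in the coefficients of `p` and `q`. -/
theorem commute_aeval_iff {k : Type*} [Field k] {n : ℕ} (M : MatPair k n) (p q : polySpace k n) :
    Commute (Polynomial.aeval M.1 (p : Polynomial k)) (Polynomial.aeval M.2 (q : Polynomial k)) ↔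
      ∀ rs, ∑ i, ∑ l, polyCoords p i * polyCoords q l *
        eval (pairCoords M) (commutatorCoeff k n rs i l) = 0 := by
  rw [commute_iff_lie_eq, aeval_eq_sum_polyCoords, aeval_eq_sum_polyCoords, ← Matrix.ext_iff,
    Prod.forall]
  refine forall₂_congr fun r s => Eq.congr ?_ rfl
  simp only [eval_commutatorCoeff, Ring.lie_def, Finset.sum_mul_sum, Matrix.sub_apply,
    Matrix.sum_apply, mul_sub, Finset.sum_sub_distrib]
  congr 1
  · simp [mul_assoc, mul_left_comm]
  · rw [Finset.sum_comm]
    simp [mul_assoc]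

/-- Constant terms do not affect commutation, so they may be assumed to vanish; a polynomial without
constant term is nonconstant as soon as it is nonzero. -/
theorem mem_PC_iff_exists_polySpace {k : Type*} [Field k] {n : ℕ} (M : MatPair k n) :
    M ∈ PC k n ↔ ∃ p q : polySpace k n, p ≠ 0 ∧ q ≠ 0 ∧
      Commute (Polynomial.aeval M.1 (p : Polynomial k))
        (Polynomial.aeval M.2 (q : Polynomial k)) := by
  have sub_const (p : Polynomial k) (h1 : 1 ≤ p.natDegree) (h2 : p.natDegree ≤ n - 1) :
      ∃ p' : polySpace k n, p' ≠ 0 ∧ (p' : Polynomial k) = p - Polynomial.C (p.coeff 0) := by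
    refine ⟨⟨p - Polynomial.C (p.coeff 0), mem_polySpace.mpr ⟨?_, by simp⟩⟩, fun h => ?_, rfl⟩
    · refine (Polynomial.degree_le_natDegree.trans_lt ?_)
      rw [Polynomial.natDegree_sub_C]
      exact_mod_cast (by omega : p.natDegree < n)
    · have := congrArg (fun r : polySpace k n => (r : Polynomial k).natDegree) h
      simp only [Polynomial.natDegree_sub_C, ZeroMemClass.coe_zero, Polynomial.natDegree_zero]
        at this
      omega
  have natDegree_mem (p : polySpace k n) (hp : p ≠ 0) :
      1 ≤ (p : Polynomial k).natDegree ∧ (p : Polynomial k).natDegree ≤ n - 1 := by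
    obtain ⟨hdeg, h0⟩ := mem_polySpace.mp p.2
    have hp' : (p : Polynomial k) ≠ 0 := by simpa using hp
    constructor
    · rw [Nat.one_le_iff_ne_zero]
      intro h
      rw [Polynomial.eq_C_of_natDegree_eq_zero h, h0, map_zero] at hp'
      exact hp' rfl
    · rw [← Polynomial.natDegree_lt_iff_degree_lt hp'] at hdeg
      omega
  constructor
  · rintro ⟨p, q, ⟨hp1, hp2⟩, ⟨hq1, hq2⟩, h⟩
    obtain ⟨p', hp0, hp'⟩ := sub_const p hp1 hp2
    obtain ⟨q', hq0, hq'⟩ := sub_const q hq1 hq2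
    refine ⟨p', q', hp0, hq0, ?_⟩
    rw [hp', hq', map_sub, map_sub, Polynomial.aeval_C, Polynomial.aeval_C]
    exact (h.sub_right (Algebra.commutes _ _).symm).sub_left
      (Algebra.commute_algebraMap_left _ _)
  · rintro ⟨p, q, hp, hq, h⟩
    exact ⟨p, q, natDegree_mem p hp, natDegree_mem q hq, h⟩

theorem fst_image_incidence (k : Type*) [Field k] (n : ℕ) :
    Prod.fst '' incidence k n = PC k n := by
  ext M
  rw [mem_PC_iff_exists_polySpace]
  constructor
  · rintro ⟨⟨M, P, Q⟩, h, rfl⟩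
    exact ⟨P.rep, Q.rep, P.rep_nonzero, Q.rep_nonzero, h⟩
  · rintro ⟨p, q, hp, hq, h⟩
    exact ⟨_, (mk_mem_incidence_iff M p q hp hq).mpr h, rfl⟩

theorem isWeightedHomogeneous_rename_zero {R σ τ : Type*} [CommSemiring R] {g : σ → τ}
    (w : τ → ℕ) (hw : ∀ x, w (g x) = 0) (f : MvPolynomial σ R) :
    (rename g f).IsWeightedHomogeneous w 0 := by
  induction f using MvPolynomial.induction_on with
  | C a => simpa using isWeightedHomogeneous_C w a
  | add p q hp hq => simpa using hp.add hq
  | mul_X p x hp =>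
    have hX := isWeightedHomogeneous_X R w (g x)
    rw [hw] at hX
    simpa using hp.mul hX

theorem isZariskiClosedMixed_incidence (k : Type*) [Field k] (n : ℕ) :
    IsZariskiClosedMixed (incidence k n) := by
  refine ⟨Set.range fun rs : Fin n × Fin n => ∑ i, ∑ l,
    rename Sum.inl (commutatorCoeff k n rs i l) * X (Sum.inr (Sum.inl i)) *
      X (Sum.inr (Sum.inr l)), ?_, ?_⟩
  · rintro _ ⟨rs, rfl⟩
    have hterm (w : MixedIdx n → ℕ) (hw : ∀ x, w (Sum.inl x) = 0) (i l : Fin (n - 1)) :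
        (rename Sum.inl (commutatorCoeff k n rs i l) * X (Sum.inr (Sum.inl i)) *
          X (Sum.inr (Sum.inr l)) : MvPolynomial (MixedIdx n) k).IsWeightedHomogeneous w
            (0 + w (Sum.inr (Sum.inl i)) + w (Sum.inr (Sum.inr l))) :=
      ((isWeightedHomogeneous_rename_zero w hw _).mul (isWeightedHomogeneous_X _ _ _)).mul
        (isWeightedHomogeneous_X _ _ _)
    exact ⟨⟨1, IsWeightedHomogeneous.sum _ _ _ fun i _ => IsWeightedHomogeneous.sum _ _ _
        fun l _ => hterm _ (fun _ => rfl) i l⟩,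
      ⟨1, IsWeightedHomogeneous.sum _ _ _ fun i _ => IsWeightedHomogeneous.sum _ _ _
        fun l _ => hterm _ (fun _ => rfl) i l⟩⟩
  · ext ⟨M, P, Q⟩
    rw [incidence, Set.mem_ofPred_eq, commute_aeval_iff, Set.mem_ofPred_eq, Set.forall_mem_range]
    refine forall_congr' fun rs => Eq.congr ?_ rfl
    have hcomp : mixedCoords M P.rep Q.rep ∘ Sum.inl = pairCoords M := rfl
    simp only [map_sum, map_mul, eval_rename, hcomp, eval_X]
    simp only [mixedCoords, Sum.elim_inl, Sum.elim_inr]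
    exact Finset.sum_congr rfl fun i _ => Finset.sum_congr rfl fun l _ => by ring

theorem isAffineVariety_PC (k : Type*) [Field k] [IsAlgClosed k] (n : ℕ) :
    IsAffineVariety (pairCoords '' PC k n) := by
  convert isAffineVariety_exists_bilinear_zero (commutatorCoeff k n) using 1
  ext x
  obtain ⟨M, rfl⟩ := pairCoords_bijective.surjective x
  rw [pairCoords_bijective.injective.mem_set_image, mem_PC_iff_exists_polySpace,
    Set.mem_ofPred_eq, polyCoords_bijective.surjective.exists₂]
  simp only [commute_aeval_iff, ne_eq, polyCoords_eq_zero_iff]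

end PolyCommuting

theorem mainTheorem8 {k : Type*} [Field k] [IsAlgClosed k] (n : ℕ) (hn : 3 ≤ n) :
    PolyCommuting.IsAffineVariety
        (PolyCommuting.pairCoords '' PolyCommuting.PC k n) ∧
      PolyCommuting.IsZariskiClosedMixed (PolyCommuting.incidence k n) ∧
      Prod.fst '' PolyCommuting.incidence k n = PolyCommuting.PC k n :=
  ⟨PolyCommuting.isAffineVariety_PC k n, PolyCommuting.isZariskiClosedMixed_incidence k n,
    PolyCommuting.fst_image_incidence k n⟩
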